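/- Let $k\in\mathbb R\setminus\{0\}$ and $2<p<\infty$. All fields are real-valued on $\mathbb R^2$; $|\cdot|_q$ is the norm of $L^q(\mathbb R^2)^6$ (with the Euclidean norm on $\mathbb R^6$) and $\langle\cdot,\cdot\rangle_2$ the inner product of $L^2(\mathbb R^2)^6$. For $\alpha,\widetilde\alpha\in C_0^\infty(\mathbb R^2)$ put $$\overset{\circ}{\nabla}\begin{pmatrix}\alpha\\ \widetilde\alpha\end{pmatrix}:=(\partial_{x_1}\alpha,\ \partial_{x_2}\alpha,\ k\widetilde\alpha,\ \partial_{x_1}\widetilde\alpha,\ \partial_{x_2}\widetilde\alpha,\ -k\alpha)^T.$$ Let $$\mathcal V:=\Big\{u\in H^1(\mathbb R^2)^6:\ \Big\langle u,\overset{\circ}{\nabla}\begin{pmatrix}\alpha\\ \widetilde\alpha\end{pmatrix}\Big\rangle_2=0\ \text{ for all }\alpha,\widetilde\alpha\in C_0^\infty(\mathbb R^2)\Big\},\qquad \|v\|:=\Big(\sum_{i=1}^6|\nabla v_i|_2^2+k^2|v_i|_2^2\Big)^{1/2}\quad(v\in\mathcal V),$$ and let $\mathcal W$ be the closure in $L^2(\mathbb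 R^2)^6\cap L^p(\mathbb R^2)^6$ of $\big\{\overset{\circ}{\nabla}(\alpha,\widetilde\alpha)^T:\alpha,\widetilde\alpha\in C_0^\infty(\mathbb R^2)\big\}$ with respect to the norm $\|w\|:=(|w|_2^2+|w|_p^2)^{1/2}$. **Theorem 2.1.** $\mathcal V$ is a closed subspace of $H^1(\mathbb R^2)^6$, $\mathcal W$ is a closed subspace of $L^2(\mathbb R^2)^6\cap L^p(\mathbb R^2)^6$, and $\mathcal V$ and $\mathcal W$ are orthogonal with respect to $\langle\cdot,\cdot\rangle_2$. In particular the sum $\mathcal V+\mathcal W\subset L^2(\mathbb R^2)^6$ is direct, and $X:=\mathcal V\oplus\mathcal W$ with the norm $\|v+w\|:=\|v\|+\|w\|$ ($v\in\mathcal V$, $w\in\mathcal W$) is the completion of $C_0^\infty(\mathbb R^2)^6$ with respect to $\|\cdot\|$: the space $X$ is complete, $C_0^\infty(\mathbb R^2)^6\subset X$, and $C_0^\infty(\mathbb R^2)^6$ is dense in $X$. -/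

import Mathlib

open MeasureTheory TopologicalSpace
open scoped ENNReal Distributions LineDeriv

noncomputable section

namespace Helmholtz

/-- The plane `ℝ²`. -/
abbrev Plane : Type := EuclideanSpace ℝ (Fin 2)

/-- `ℝ⁶` with its Euclidean norm. A field `(U, Ũ)` has components `U₁, U₂, U₃, Ũ₁, Ũ₂, Ũ₃`,
numbered `0, …, 5`. -/
abbrev R6 : Type := EuclideanSpace ℝ (Fin 6)

/-- `C_0^∞(ℝ²; F)`: smooth compactly supported functions. -/
abbrev Test (F : Type) [NormedAddCommGroup F] [NormedSpace ℝ F] : Type :=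
  𝓓((⊤ : Opens Plane), F)

/-- `L²(ℝ²)⁶`. -/
abbrev L2 : Type := Lp R6 2 (volume : Measure Plane)

/-- The standard basis vectors of the plane, so that `∂_{e 0} φ = ∂ₓφ`, `∂_{e 1} φ = ∂_yφ`. -/
def e (i : Fin 2) : Plane := EuclideanSpace.single i 1

theorem test_memLp {F : Type} [NormedAddCommGroup F] [NormedSpace ℝ F] (φ : Test F)
    (q : ℝ≥0∞) : MemLp (⇑φ) q (volume : Measure Plane) :=
  φ.continuous.memLp_of_hasCompactSupport φ.hasCompactSupport

/-- The class in `L²(ℝ²)⁶` of a test field. -/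
def testToL2 : Test R6 →ₗ[ℝ] L2 where
  toFun φ := (test_memLp φ 2).toLp φ
  map_add' _ _ := rfl
  map_smul' _ _ := rfl

/-! ### The Sobolev space `H¹(ℝ²)⁶` -/

/-- `g` is the `i`-th weak partial derivative of `u`. -/
def IsWeakPartial (i : Fin 2) (u g : L2) : Prop :=
  ∀ φ : Test ℝ, ∫ x, (∂_{e i} φ) x • u x = -∫ x, φ x • g x

theorem integrable_test_smul (φ : Test ℝ) (u : L2) : Integrable fun x => φ x • u x :=
  memLp_one_iff_integrable.1 ((Lp.memLp u).smul (test_memLp φ 2))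

theorem IsWeakPartial.add {i : Fin 2} {u v g h : L2} (hu : IsWeakPartial i u g)
    (hv : IsWeakPartial i v h) : IsWeakPartial i (u + v) (g + h) := by
  intro φ
  have key : ∀ (ψ : Test ℝ) (a b : L2),
      ∫ x, ψ x • (a + b) x = (∫ x, ψ x • a x) + ∫ x, ψ x • b x := by
    intro ψ a b
    rw [← integral_add (integrable_test_smul ψ a) (integrable_test_smul ψ b)]
    refine integral_congr_ae ?_
    filter_upwards [Lp.coeFn_add a b] with x hx
    rw [hx, Pi.add_apply, smul_add]
  rw [key, key, hu φ, hv φ]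
  abel

theorem IsWeakPartial.smul {i : Fin 2} {u g : L2} (c : ℝ) (hu : IsWeakPartial i u g) :
    IsWeakPartial i (c • u) (c • g) := by
  intro φ
  have key : ∀ (ψ : Test ℝ) (a : L2), ∫ x, ψ x • (c • a) x = c • ∫ x, ψ x • a x := by
    intro ψ a
    rw [← integral_smul]
    refine integral_congr_ae ?_
    filter_upwards [Lp.coeFn_smul c a] with x hx
    rw [hx, Pi.smul_apply, smul_comm]
  rw [key, key, hu φ, smul_neg]

theorem IsWeakPartial.zero (i : Fin 2) : IsWeakPartial i 0 0 := by
  have h : ∀ ψ : Test ℝ, ∫ x, ψ x • (0 : L2) x = 0 := by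
    intro ψ
    refine (integral_congr_ae ?_).trans (integral_zero Plane R6)
    filter_upwards [Lp.coeFn_zero R6 2 (volume : Measure Plane)] with x hx
    rw [hx, Pi.zero_apply, smul_zero]
  intro φ
  rw [h, h, neg_zero]

theorem IsWeakPartial.unique {i : Fin 2} {u g h : L2} (hg : IsWeakPartial i u g)
    (hh : IsWeakPartial i u h) : g = h := by
  have h0 : IsWeakPartial i (u + (-1 : ℝ) • u) (g + (-1 : ℝ) • h) := hg.add (hh.smul _)
  rw [neg_one_smul, add_neg_cancel, neg_one_smul, ← sub_eq_add_neg] at h0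
  have hz : ∀ φ : Test ℝ, ∫ x, φ x • (g - h) x = 0 := by
    intro φ
    have h1 := h0 φ
    rw [IsWeakPartial.zero i φ] at h1
    have h2 : ∫ x, φ x • (0 : L2) x = 0 := by
      refine (integral_congr_ae ?_).trans (integral_zero Plane R6)
      filter_upwards [Lp.coeFn_zero R6 2 (volume : Measure Plane)] with x hx
      rw [hx, Pi.zero_apply, smul_zero]
    rw [h2, neg_zero] at h1
    exact neg_eq_zero.1 h1.symm
  have hloc : LocallyIntegrable (⇑(g - h)) (volume : Measure Plane) :=
    (Lp.memLp (g - h)).locallyIntegrable (by norm_num)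
  have h3 := ae_eq_zero_of_integral_contDiff_smul_eq_zero hloc
    (fun ψ hψ hc => hz ⟨ψ, hψ, hc, fun _ _ => trivial⟩)
  exact sub_eq_zero.1 ((Lp.eq_zero_iff_ae_eq_zero).2 h3)

/-- The subspace of `L²(ℝ²)⁶` of fields all of whose weak partial derivatives are in `L²`. -/
def h1Submodule : Submodule ℝ L2 where
  carrier := {u | ∀ i, ∃ g, IsWeakPartial i u g}
  add_mem' hu hv i := ⟨_, (hu i).choose_spec.add (hv i).choose_spec⟩
  zero_mem' i := ⟨0, IsWeakPartial.zero i⟩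
  smul_mem' c _ hu i := ⟨_, (hu i).choose_spec.smul c⟩

/-- `H¹(ℝ²)⁶`; a type of its own, so that it does not carry the norm of `L²`. -/
def H1 : Type := ↥h1Submodule

instance : AddCommGroup H1 := inferInstanceAs (AddCommGroup ↥h1Submodule)
instance : Module ℝ H1 := inferInstanceAs (Module ℝ ↥h1Submodule)

/-- The inclusion `H¹(ℝ²)⁶ ⊂ L²(ℝ²)⁶`. -/
def H1.toL2 : H1 →ₗ[ℝ] L2 := h1Submodule.subtype

theorem H1.toL2_injective : Function.Injective H1.toL2 := Subtype.val_injective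

/-- The weak partial derivative `∂ᵢu` of `u ∈ H¹(ℝ²)⁶`. -/
def H1.partial (i : Fin 2) : H1 →ₗ[ℝ] L2 where
  toFun u := (u.2 i).choose
  map_add' u v := (((u + v).2 i).choose_spec).unique
    ((u.2 i).choose_spec.add (v.2 i).choose_spec)
  map_smul' c u := (((c • u).2 i).choose_spec).unique ((u.2 i).choose_spec.smul c)

theorem H1.isWeakPartial (i : Fin 2) (u : H1) : IsWeakPartial i (H1.toL2 u) (H1.partial i u) :=
  (u.2 i).choose_spec

/-- The map `u ↦ (c u, ∂₁u, ∂₂u)` from `H¹` to a Hilbert sum of copies of `L²`. -/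
def H1.jet (c : ℝ) : H1 →ₗ[ℝ] WithLp 2 (L2 × PiLp 2 fun _ : Fin 2 => L2) where
  toFun u := WithLp.toLp 2 (c • H1.toL2 u, WithLp.toLp 2 fun i => H1.partial i u)
  map_add' u v := by
    simp only [map_add, smul_add]
    rfl
  map_smul' a u := by
    simp only [map_smul, smul_comm c a]
    rfl

theorem H1.jet_injective {c : ℝ} (hc : c ≠ 0) : Function.Injective (H1.jet c) := by
  intro u v h
  have h1 : c • H1.toL2 u = c • H1.toL2 v := congrArg (fun z => z.fst) h
  exact H1.toL2_injective (smul_right_injective L2 hc h1)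

theorem H1.norm_jet (c : ℝ) (u : H1) :
    ‖H1.jet c u‖ = √(∑ i, ‖H1.partial i u‖ ^ 2 + c ^ 2 * ‖H1.toL2 u‖ ^ 2) := by
  rw [WithLp.prod_norm_eq_of_L2, PiLp.norm_sq_eq_of_L2, add_comm]
  have h : ‖(H1.jet c u).fst‖ ^ 2 = c ^ 2 * ‖H1.toL2 u‖ ^ 2 := by
    change ‖c • H1.toL2 u‖ ^ 2 = _
    rw [norm_smul, mul_pow, Real.norm_eq_abs, sq_abs]
  rw [h]
  rfl

/-- The standard norm of `H¹(ℝ²)⁶`; see `H1.norm_eq`. -/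
instance : NormedAddCommGroup H1 :=
  NormedAddCommGroup.induced H1 _ (H1.jet 1) (H1.jet_injective one_ne_zero)

instance : NormedSpace ℝ H1 := NormedSpace.induced ℝ H1 _ (H1.jet 1)

theorem H1.norm_eq (u : H1) :
    ‖u‖ = √(∑ i, ‖H1.partial i u‖ ^ 2 + ‖H1.toL2 u‖ ^ 2) := by
  change ‖H1.jet 1 u‖ = _
  rw [H1.norm_jet, one_pow, one_mul]

/-! ### The space `L²(ℝ²)⁶ ∩ Lᵖ(ℝ²)⁶` -/

/-- The subspace of `L²(ℝ²)⁶` of fields that are also in `Lᵖ`. -/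
def l2lpSubmodule (p : ℝ≥0∞) : Submodule ℝ L2 where
  carrier := {u | MemLp (⇑u) p (volume : Measure Plane)}
  add_mem' {u v} hu hv := (hu.add hv).ae_eq (Lp.coeFn_add u v).symm
  zero_mem' := MemLp.zero.ae_eq (Lp.coeFn_zero R6 2 volume).symm
  smul_mem' c u hu := (hu.const_smul c).ae_eq (Lp.coeFn_smul c u).symm

/-- `L²(ℝ²)⁶ ∩ Lᵖ(ℝ²)⁶`; a type of its own, so that it does not carry the norm of `L²`. -/
def L2Lp (p : ℝ≥0∞) : Type := ↥(l2lpSubmodule p)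

section

variable (p : ℝ≥0∞)

instance : AddCommGroup (L2Lp p) := inferInstanceAs (AddCommGroup ↥(l2lpSubmodule p))
instance : Module ℝ (L2Lp p) := inferInstanceAs (Module ℝ ↥(l2lpSubmodule p))

/-- The inclusion `L² ∩ Lᵖ ⊂ L²`. -/
def L2Lp.toL2 : L2Lp p →ₗ[ℝ] L2 := (l2lpSubmodule p).subtype

/-- The inclusion `L² ∩ Lᵖ ⊂ Lᵖ`. -/
def L2Lp.toLp : L2Lp p →ₗ[ℝ] Lp R6 p (volume : Measure Plane) where
  toFun u := MemLp.toLp _ u.2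
  map_add' u v := (MemLp.toLp_congr (u + v).2 (u.2.add v.2) (Lp.coeFn_add u.1 v.1)).trans
    (MemLp.toLp_add u.2 v.2)
  map_smul' c u := (MemLp.toLp_congr (c • u).2 (u.2.const_smul c) (Lp.coeFn_smul c u.1)).trans
    (MemLp.toLp_const_smul c u.2)

theorem L2Lp.toLp_ae_eq (u : L2Lp p) : L2Lp.toLp p u =ᵐ[volume] L2Lp.toL2 p u :=
  MemLp.coeFn_toLp u.2

/-- The map `u ↦ (u, u)` from `L² ∩ Lᵖ` to `L² × Lᵖ`. -/
def L2Lp.pair : L2Lp p →ₗ[ℝ] WithLp 2 (L2 × Lp R6 p (volume : Measure Plane)) where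
  toFun u := WithLp.toLp 2 (L2Lp.toL2 p u, L2Lp.toLp p u)
  map_add' u v := by
    simp only [map_add]
    rfl
  map_smul' a u := by
    simp only [map_smul]
    rfl

theorem L2Lp.pair_injective : Function.Injective (L2Lp.pair p) := by
  intro u v h
  have h1 : L2Lp.toL2 p u = L2Lp.toL2 p v := congrArg (fun z => z.fst) h
  exact Subtype.val_injective h1

/-- The norm `(|u|₂² + |u|ₚ²)^{1/2}` on `L² ∩ Lᵖ`; see `L2Lp.norm_eq`. -/
instance [Fact (1 ≤ p)] : NormedAddCommGroup (L2Lp p) :=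
  NormedAddCommGroup.induced (L2Lp p) _ (L2Lp.pair p) (L2Lp.pair_injective p)

instance [Fact (1 ≤ p)] : NormedSpace ℝ (L2Lp p) :=
  NormedSpace.induced ℝ (L2Lp p) _ (L2Lp.pair p)

theorem L2Lp.norm_eq [Fact (1 ≤ p)] (u : L2Lp p) :
    ‖u‖ = √(‖L2Lp.toL2 p u‖ ^ 2 + ‖L2Lp.toLp p u‖ ^ 2) :=
  WithLp.prod_norm_eq_of_L2 (L2Lp.pair p u)

/-- The class in `L² ∩ Lᵖ` of a test field. -/
def testToL2Lp : Test R6 →ₗ[ℝ] L2Lp p where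
  toFun φ := ⟨testToL2 φ, (test_memLp φ p).ae_eq (MemLp.coeFn_toLp (test_memLp φ 2)).symm⟩
  map_add' _ _ := rfl
  map_smul' _ _ := rfl

end

/-! ### The gradient and the spaces `𝒱`, `𝒲`, `X` -/

/-- The field `(∂ₓα, ∂_yα, kα̃, ∂ₓα̃, ∂_yα̃, -kα)`, for scalar test functions `α` and `α̃ = β`. -/
def gradFun (k : ℝ) (α β : Test ℝ) (x : Plane) : R6 :=
  !₂[(∂_{e 0} α) x, (∂_{e 1} α) x, k * β x, (∂_{e 0} β) x, (∂_{e 1} β) x, -(k * α x)]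

theorem contDiff_gradFun (k : ℝ) (α β : Test ℝ) : ContDiff ℝ (⊤ : ℕ∞) (gradFun k α β) := by
  rw [contDiff_euclidean]
  intro i
  fin_cases i
  · exact (∂_{e 0} α).contDiff
  · exact (∂_{e 1} α).contDiff
  · exact contDiff_const.mul β.contDiff
  · exact (∂_{e 0} β).contDiff
  · exact (∂_{e 1} β).contDiff
  · exact (contDiff_const.mul α.contDiff).neg

theorem hasCompactSupport_gradFun (k : ℝ) (α β : Test ℝ) :
    HasCompactSupport (gradFun k α β) := by
  have hK := (((∂_{e 0} α).hasCompactSupport.isCompact.union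
    (∂_{e 1} α).hasCompactSupport.isCompact).union
    ((∂_{e 0} β).hasCompactSupport.isCompact.union
    (∂_{e 1} β).hasCompactSupport.isCompact)).union
    (α.hasCompactSupport.isCompact.union β.hasCompactSupport.isCompact)
  refine HasCompactSupport.intro hK ?_
  intro x hx
  simp only [Set.mem_union, not_or] at hx
  obtain ⟨⟨⟨h1, h2⟩, h3, h4⟩, h5, h6⟩ := hx
  rw [gradFun, image_eq_zero_of_notMem_tsupport h1, image_eq_zero_of_notMem_tsupport h2,
    image_eq_zero_of_notMem_tsupport h3, image_eq_zero_of_notMem_tsupport h4,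
    image_eq_zero_of_notMem_tsupport h5, image_eq_zero_of_notMem_tsupport h6]
  ext i
  fin_cases i <;> simp

theorem gradFun_add (k : ℝ) (α β α' β' : Test ℝ) (x : Plane) :
    gradFun k (α + α') (β + β') x = gradFun k α β x + gradFun k α' β' x := by
  have h : ∀ (i : Fin 2) (f g : Test ℝ), (∂_{e i} (f + g)) x = (∂_{e i} f) x + (∂_{e i} g) x := by
    intro i f g
    rw [LineDeriv.lineDerivOp_add]
    rfl
  have h' : ∀ f g : Test ℝ, (f + g) x = f x + g x := fun _ _ => rfl
  unfold gradFun
  simp only [h, h']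
  ext i
  fin_cases i <;> simp <;> ring

theorem gradFun_smul (k c : ℝ) (α β : Test ℝ) (x : Plane) :
    gradFun k (c • α) (c • β) x = c • gradFun k α β x := by
  have h : ∀ (i : Fin 2) (f : Test ℝ), (∂_{e i} (c • f)) x = c * (∂_{e i} f) x := by
    intro i f
    rw [LineDeriv.lineDerivOp_smul]
    rfl
  have h' : ∀ f : Test ℝ, (c • f) x = c * f x := fun _ => rfl
  unfold gradFun
  simp only [h, h']
  ext i
  fin_cases i <;> simp <;> ring

/-- The gradient `(α, β) ↦ gradFun k α β` as a linear map into test fields. -/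
def grad (k : ℝ) : Test ℝ × Test ℝ →ₗ[ℝ] Test R6 where
  toFun a := ⟨gradFun k a.1 a.2, contDiff_gradFun k a.1 a.2, hasCompactSupport_gradFun k a.1 a.2,
    fun _ _ => trivial⟩
  map_add' a b := TestFunction.ext fun x => gradFun_add k a.1 a.2 b.1 b.2 x
  map_smul' c a := TestFunction.ext fun x => gradFun_smul k c a.1 a.2 x

/-- `𝒱`: the fields in `H¹(ℝ²)⁶` that are `L²`-orthogonal to all gradients of test functions. -/
def V (k : ℝ) : Submodule ℝ H1 where
  carrier := {u | ∀ α β : Test ℝ, inner ℝ (H1.toL2 u) (testToL2 (grad k (α, β))) = 0}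
  add_mem' hu hv α β := by rw [map_add, inner_add_left, hu α β, hv α β, add_zero]
  zero_mem' α β := by rw [map_zero, inner_zero_left]
  smul_mem' c u hu α β := by rw [map_smul, inner_smul_left, hu α β, mul_zero]

/-- `𝒲`: the closure in `L² ∩ Lᵖ` of the gradients of test functions, that is their completion
with respect to the norm `(|·|₂² + |·|ₚ²)^{1/2}`. -/
def W (k : ℝ) (p : ℝ≥0∞) [Fact (1 ≤ p)] : Submodule ℝ (L2Lp p) :=
  (LinearMap.range (testToL2Lp p ∘ₗ grad k)).topologicalClosure

/-- `𝒱` with the norm `(∑ᵢ |∇uᵢ|₂² + k²|uᵢ|₂²)^{1/2}`, the sum running over the six components;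
see `VSpace.norm_eq`. As a subspace of `H1`, `V k` carries the standard norm of `H¹` instead. -/
def VSpace (k : ℝ) : Type := ↥(V k)

section

variable (k : ℝ)

instance : AddCommGroup (VSpace k) := inferInstanceAs (AddCommGroup ↥(V k))
instance : Module ℝ (VSpace k) := inferInstanceAs (Module ℝ ↥(V k))

/-- The inclusion `𝒱 ⊂ H¹(ℝ²)⁶`. -/
def VSpace.toH1 : VSpace k →ₗ[ℝ] H1 := (V k).subtype

theorem VSpace.jet_injective [NeZero k] :
    Function.Injective (H1.jet k ∘ₗ VSpace.toH1 k) :=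
  (H1.jet_injective (NeZero.ne k)).comp Subtype.val_injective

instance [NeZero k] : NormedAddCommGroup (VSpace k) :=
  NormedAddCommGroup.induced (VSpace k) _ (H1.jet k ∘ₗ VSpace.toH1 k) (VSpace.jet_injective k)

instance [NeZero k] : NormedSpace ℝ (VSpace k) :=
  NormedSpace.induced ℝ (VSpace k) _ (H1.jet k ∘ₗ VSpace.toH1 k)

theorem VSpace.norm_eq [NeZero k] (v : VSpace k) :
    ‖v‖ = √(∑ i, ‖H1.partial i (VSpace.toH1 k v)‖ ^ 2
      + k ^ 2 * ‖H1.toL2 (VSpace.toH1 k v)‖ ^ 2) :=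
  H1.norm_jet k (VSpace.toH1 k v)

variable (p : ℝ≥0∞) [Fact (1 ≤ p)]

/-- `X = 𝒱 ⊕ 𝒲`, with the norm `‖v + w‖ = ‖v‖ + ‖w‖`; see `X.norm_eq`. -/
abbrev X : Type := WithLp 1 (VSpace k × ↥(W k p))

theorem X.norm_eq [NeZero k] (u : X k p) : ‖u‖ = ‖u.fst‖ + ‖u.snd‖ :=
  WithLp.prod_norm_eq_of_L1 u

/-- The field `v + w ∈ L²(ℝ²)⁶` given by the element `(v, w)` of `𝒱 ⊕ 𝒲`. -/
def X.toL2 : X k p →ₗ[ℝ] L2 where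
  toFun u := H1.toL2 (VSpace.toH1 k u.fst) + L2Lp.toL2 p u.snd
  map_add' u v := by
    simp only [WithLp.add_fst, WithLp.add_snd, Submodule.coe_add, map_add]
    abel
  map_smul' c u := by
    simp only [WithLp.smul_fst, WithLp.smul_snd, Submodule.coe_smul, map_smul, smul_add,
      RingHom.id_apply]

end

end Helmholtz

end

/-!
# The Helmholtz decomposition for fields with values in `ℝ⁶`

The decomposition is explicit on Schwartz fields. Let `s` be a Schwartz field with values in `ℝ⁶`.
The formal adjoint of the gradient is the pair `(divFst k, divSnd k)`, and its composition with the
gradient acts as `k² - Δ` on each of the two potentials (`divFst_schwartzGrad`,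
`divSnd_schwartzGrad`). Since `k ≠ 0`, the operator `k² - Δ` is onto on the Schwartz space: it is
inverted by the Fourier multiplier `(k² + 4π²|ξ|²)⁻¹` (`helmOp_surjective`). Hence there are Schwartz
potentials `(α, β)` such that `s - ∇(α, β)` has vanishing divergences, that is, lies in `𝒱`. Test
functions are dense in the Schwartz space (`denseRange_testToSchwartz`, by cutting off), and the
Schwartz topology is finer than that of `L² ∩ Lᵖ`, so `∇(α, β)` lies in `𝒲`. This embeds the test
fields into `X = 𝒱 ⊕ 𝒲` (`testToX`).

Density in `X`: gradients of test functions are test fields and belong to `𝒲`, so the closure of the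
test fields contains `{0} × 𝒲`, and it remains to see that the `𝒱`-parts of the test fields are
dense in `𝒱`. Let `v ∈ 𝒱` be orthogonal to all of them with respect to the inner product
`∑ ⟨∂ᵢ·, ∂ᵢ·⟩ + k² ⟨·, ·⟩`. Integrating by parts, and using that `k² - Δ` commutes with the gradient
and that `v` is orthogonal to gradients of Schwartz functions, one gets `⟨v, (k² - Δ) φ⟩ = 0` for all
test fields `φ`, hence for all Schwartz fields, hence `v = 0` because `k² - Δ` is onto. In this way
neither Sobolev embeddings nor the density of test fields in `H¹` are needed.

Closedness, orthogonality and directness of the sum follow from continuity, and completeness from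
the fact that the jet map on `𝒱` and the map `L² ∩ Lᵖ → L² × Lᵖ` are isometries with closed range.
-/

noncomputable section

namespace Helmholtz

open scoped SchwartzMap ContDiff Topology
open Filter

/-! ### Compactly supported functions are dense in the Schwartz space -/

section Cutoff

variable {E F : Type} [NormedAddCommGroup E] [NormedSpace ℝ E] [NormedAddCommGroup F]
  [NormedSpace ℝ F]

/-- If `η` has bounded derivatives and vanishes on the unit ball, then the product of a Schwartz
function `f` with the dilate `η (c ·)` is small for small `c`: where `η (c x) ≠ 0` one has
`1 ≤ c ‖x‖`, so that one power of `‖x‖` buys a factor `c`. -/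
theorem seminorm_le_of_eq_dilate_smul {η : E → ℝ} (hη : ContDiff ℝ ∞ η) {B : ℕ → ℝ}
    (hB : ∀ j x, ‖iteratedFDeriv ℝ j η x‖ ≤ B j) (h0 : ∀ x, ‖x‖ < 1 → η x = 0)
    (f : 𝓢(E, F)) (k m : ℕ) {c : ℝ} (hc : 0 < c) (hc1 : c ≤ 1) (g : 𝓢(E, F))
    (hg : ∀ x, g x = η (c • x) • f x) :
    SchwartzMap.seminorm ℝ k m g ≤
      c * ∑ j ∈ Finset.range (m + 1),
        (m.choose j : ℝ) * B j * SchwartzMap.seminorm ℝ (k + 1) (m - j) f := by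
  have hB0 : ∀ j, 0 ≤ B j := fun j => (norm_nonneg _).trans (hB j 0)
  have hnn : 0 ≤ ∑ j ∈ Finset.range (m + 1),
      (m.choose j : ℝ) * B j * SchwartzMap.seminorm ℝ (k + 1) (m - j) f :=
    Finset.sum_nonneg fun j _ => mul_nonneg (mul_nonneg (Nat.cast_nonneg _) (hB0 j))
      (apply_nonneg _ _)
  refine SchwartzMap.seminorm_le_bound ℝ k m g (mul_nonneg hc.le hnn) fun x => ?_
  have hgf : (g : E → F) = fun y => η (c • y) • f y := funext hg
  have hηc : ContDiff ℝ ∞ fun y : E => η (c • y) := hη.comp (contDiff_const_smul c)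
  by_cases hx : c * ‖x‖ < 1
  · have hev : (g : E → F) =ᶠ[𝓝 x] fun _ => 0 := by
      have : ∀ᶠ y in 𝓝 x, c * ‖y‖ < 1 :=
        (continuous_const.mul continuous_norm).continuousAt.eventually_lt_const hx
      filter_upwards [this] with y hy
      rw [hg, h0, zero_smul]
      rwa [norm_smul, Real.norm_of_nonneg hc.le]
    have hz : iteratedFDeriv ℝ m (g : E → F) x = 0 := by
      rw [Filter.EventuallyEq.eq_of_nhds (Filter.EventuallyEq.iteratedFDeriv ℝ hev m)]
      simp
    rw [hz, norm_zero, mul_zero]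
    exact mul_nonneg hc.le hnn
  · push Not at hx
    have hder : ∀ j, ‖iteratedFDeriv ℝ j (fun y : E => η (c • y)) x‖ ≤ B j := by
      intro j
      have h1 := (c • ContinuousLinearMap.id ℝ E).iteratedFDeriv_comp_right (f := η) hη x
        (i := j) (by exact_mod_cast le_top)
      have h2 : (fun y : E => η (c • y)) = η ∘ (c • ContinuousLinearMap.id ℝ E) := rfl
      rw [h2, h1]
      refine (ContinuousMultilinearMap.norm_compContinuousLinearMap_le _ _).trans ?_
      refine (mul_le_of_le_one_right (norm_nonneg _) ?_).trans (hB j _)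
      refine Finset.prod_le_one (fun _ _ => norm_nonneg _) fun _ _ => ?_
      refine (norm_smul_le _ _).trans ?_
      rw [Real.norm_of_nonneg hc.le]
      exact (mul_le_of_le_one_right hc.le ContinuousLinearMap.norm_id_le).trans hc1
    calc ‖x‖ ^ k * ‖iteratedFDeriv ℝ m (g : E → F) x‖
        ≤ ‖x‖ ^ k * ∑ j ∈ Finset.range (m + 1), (m.choose j : ℝ) *
            ‖iteratedFDeriv ℝ j (fun y : E => η (c • y)) x‖ *
            ‖iteratedFDeriv ℝ (m - j) f x‖ := by
          rw [hgf]
          gcongr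
          exact norm_iteratedFDeriv_smul_le hηc (f.smooth ⊤) x (by exact_mod_cast le_top)
      _ ≤ (c * ‖x‖) * (‖x‖ ^ k * ∑ j ∈ Finset.range (m + 1), (m.choose j : ℝ) *
            ‖iteratedFDeriv ℝ j (fun y : E => η (c • y)) x‖ *
            ‖iteratedFDeriv ℝ (m - j) f x‖) := le_mul_of_one_le_left (by positivity) hx
      _ = c * ∑ j ∈ Finset.range (m + 1), (m.choose j : ℝ) *
            ‖iteratedFDeriv ℝ j (fun y : E => η (c • y)) x‖ *
            (‖x‖ ^ (k + 1) * ‖iteratedFDeriv ℝ (m - j) f x‖) := by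
          rw [Finset.mul_sum, Finset.mul_sum, Finset.mul_sum]
          exact Finset.sum_congr rfl fun j _ => by ring
      _ ≤ _ := by
          gcongr with j _
          · exact mul_nonneg (Nat.cast_nonneg _) (hB0 j)
          · exact hder j
          · exact SchwartzMap.le_seminorm ℝ (k + 1) (m - j) f x

theorem dense_setOf_hasCompactSupport [FiniteDimensional ℝ E] [HasContDiffBump E] :
    Dense {f : 𝓢(E, F) | HasCompactSupport f} := by
  intro f
  let χ : ContDiffBump (0 : E) := ⟨1, 2, one_pos, one_lt_two⟩
  have hχ : ContDiff ℝ ∞ χ := χ.contDiff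
  let χS : 𝓢(E, ℝ) := χ.hasCompactSupport.toSchwartzMap hχ
  let η : E → ℝ := fun x => 1 - χ x
  have hη : ContDiff ℝ ∞ η := contDiff_const.sub hχ
  let B : ℕ → ℝ := fun j => 1 + SchwartzMap.seminorm ℝ 0 j χS
  have hB : ∀ j x, ‖iteratedFDeriv ℝ j η x‖ ≤ B j := by
    intro j x
    have h1 : iteratedFDeriv ℝ j η x
        = iteratedFDeriv ℝ j (fun _ : E => (1 : ℝ)) x - iteratedFDeriv ℝ j χ x :=
      iteratedFDeriv_sub_apply (contDiff_const.contDiffAt)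
        ((hχ.of_le (by exact_mod_cast le_top)).contDiffAt)
    rw [h1]
    refine (norm_sub_le _ _).trans (add_le_add ?_
      (SchwartzMap.norm_iteratedFDeriv_le_seminorm ℝ χS j x))
    rcases eq_or_ne j 0 with rfl | hj
    · simp
    · simp [iteratedFDeriv_const_of_ne hj]
  have h0 : ∀ x, ‖x‖ < 1 → η x = 0 := by
    intro x hx
    have : χ x = 1 := χ.one_of_mem_closedBall (by simpa using hx.le)
    simp [η, this]
  let c : ℕ → ℝ := fun n => 1 / ((n : ℝ) + 1)
  have hc : ∀ n, 0 < c n := fun n => Nat.one_div_pos_of_nat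
  have hc1 : ∀ n, c n ≤ 1 := fun n => by
    simp only [c]
    rw [div_le_one (by positivity)]
    linarith [n.cast_nonneg (α := ℝ)]
  have hχc : ∀ n, HasCompactSupport fun x : E => χ (c n • x) := fun n =>
    χ.hasCompactSupport.comp_homeomorph (Homeomorph.smulOfNeZero (c n) (hc n).ne')
  have hχt : ∀ n, (fun x : E => χ (c n • x)).HasTemperateGrowth := fun n =>
    (hχc n).hasTemperateGrowth (hχ.comp (contDiff_const_smul (c n)))
  let g : ℕ → 𝓢(E, F) := fun n => SchwartzMap.smulLeftCLM F (fun x : E => χ (c n • x)) f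
  have hg : ∀ n x, g n x = χ (c n • x) • f x := fun n x =>
    SchwartzMap.smulLeftCLM_apply_apply (hχt n) f x
  have hcomp : ∀ n, HasCompactSupport (g n) := fun n => by
    have : (g n : E → F) = (fun x : E => χ (c n • x)) • (f : E → F) := funext (hg n)
    rw [this]
    exact (hχc n).smul_right
  refine mem_closure_of_tendsto (b := atTop) (f := g)
    (s := {f : 𝓢(E, F) | HasCompactSupport f}) ?_ (Eventually.of_forall hcomp)
  rw [(schwartz_withSeminorms ℝ E F).tendsto_nhds]
  rintro ⟨k, m⟩ ε hε
  have hlim : Tendsto (fun n => c n * ∑ j ∈ Finset.range (m + 1),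
      (m.choose j : ℝ) * B j * SchwartzMap.seminorm ℝ (k + 1) (m - j) f) atTop (𝓝 0) := by
    simpa [c] using (tendsto_one_div_add_atTop_nhds_zero_nat (𝕜 := ℝ)).mul_const
      (∑ j ∈ Finset.range (m + 1),
        (m.choose j : ℝ) * B j * SchwartzMap.seminorm ℝ (k + 1) (m - j) f)
  filter_upwards [hlim.eventually_lt_const hε] with n hn
  rw [← neg_sub, map_neg_eq_map]
  refine (seminorm_le_of_eq_dilate_smul hη hB h0 f k m (hc n) (hc1 n) _ fun x => ?_).trans_lt hn
  simp [hg, η, sub_smul]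

end Cutoff

/-- A test function, viewed as a Schwartz function. -/
def testToSchwartz {F : Type} [NormedAddCommGroup F] [NormedSpace ℝ F] (φ : Test F) :
    𝓢(Plane, F) :=
  φ.hasCompactSupport.toSchwartzMap φ.contDiff

@[simp]
theorem testToSchwartz_apply {F : Type} [NormedAddCommGroup F] [NormedSpace ℝ F] (φ : Test F)
    (x : Plane) : testToSchwartz φ x = φ x := rfl

theorem denseRange_testToSchwartz {F : Type} [NormedAddCommGroup F] [NormedSpace ℝ F] :
    DenseRange (testToSchwartz (F := F)) := by
  refine dense_setOf_hasCompactSupport.mono fun f hf => ?_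
  exact ⟨⟨f, f.smooth ⊤, hf, fun _ _ => trivial⟩, SchwartzMap.ext fun _ => rfl⟩

/-! ### The operator `k² - Δ` on Schwartz functions -/

section Resolvent

variable {F G : Type} [NormedAddCommGroup F] [NormedSpace ℝ F] [NormedAddCommGroup G]
  [NormedSpace ℝ G]

theorem lineDerivOp_comm (v w : Plane) (f : 𝓢(Plane, F)) : ∂_{v} (∂_{w} f) = ∂_{w} (∂_{v} f) := by
  have key : ∀ (a b x : Plane), (∂_{a} (∂_{b} f)) x = fderiv ℝ (fderiv ℝ f) x a b := by
    intro a b x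
    rw [SchwartzMap.lineDerivOp_apply_eq_fderiv]
    have h1 : ((∂_{b} f : 𝓢(Plane, F)) : Plane → F) = fun y => fderiv ℝ f y b := rfl
    have h2 : DifferentiableAt ℝ (fderiv ℝ f) x :=
      (SchwartzMap.fderivCLM ℝ Plane F f).differentiableAt
    rw [h1, fderiv_clm_apply h2 (differentiableAt_const b)]
    simp
  ext x
  rw [key, key]
  exact ((f.smooth 2).contDiffAt.isSymmSndFDerivAt (by simp)) v w

theorem lineDerivOp_postcompCLM (v : Plane) (A : F →L[ℝ] G) (f : 𝓢(Plane, F)) :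
    ∂_{v} (f.postcompCLM A) = (∂_{v} f : 𝓢(Plane, F)).postcompCLM A := by
  ext x
  have h1 : ((f.postcompCLM A : 𝓢(Plane, G)) : Plane → G) = A ∘ f := rfl
  rw [SchwartzMap.lineDerivOp_apply_eq_fderiv, h1,
    (A.hasFDerivAt.comp x f.differentiableAt.hasFDerivAt).fderiv]
  rfl

/-- The operator `f ↦ k² f - Δf` on Schwartz functions on the plane. -/
def helmOp (k : ℝ) : 𝓢(Plane, F) →ₗ[ℝ] 𝓢(Plane, F) where
  toFun f := k ^ 2 • f - ∑ i, ∂_{e i} (∂_{e i} f)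
  map_add' f g := by
    simp only [smul_add, LineDeriv.lineDerivOp_add, Finset.sum_add_distrib]
    abel
  map_smul' c f := by
    simp only [LineDeriv.lineDerivOp_smul, smul_sub, Finset.smul_sum, RingHom.id_apply,
      smul_comm c]

theorem helmOp_apply (k : ℝ) (f : 𝓢(Plane, F)) :
    helmOp k f = k ^ 2 • f - ∑ i, ∂_{e i} (∂_{e i} f) := rfl

theorem continuous_helmOp (k : ℝ) :
    Continuous (helmOp k : 𝓢(Plane, F) →ₗ[ℝ] 𝓢(Plane, F)) := by
  let D := fun i => LineDeriv.lineDerivOpCLM ℝ 𝓢(Plane, F) (e i)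
  exact (k ^ 2 • ContinuousLinearMap.id ℝ 𝓢(Plane, F) - ∑ i, D i ∘L D i).continuous.congr
    fun f => by simp [helmOp_apply, D]

theorem helmOp_postcompCLM (k : ℝ) (A : F →L[ℝ] G) (f : 𝓢(Plane, F)) :
    helmOp k (f.postcompCLM A) = (helmOp k f).postcompCLM A := by
  simp only [helmOp_apply, lineDerivOp_postcompCLM, map_sub, map_sum, map_smul]

theorem helmOp_lineDerivOp (k : ℝ) (v : Plane) (f : 𝓢(Plane, F)) :
    helmOp k (∂_{v} f) = ∂_{v} (helmOp k f) := by
  have h := (LineDeriv.lineDerivOpCLM ℝ 𝓢(Plane, F) v).map_sub (k ^ 2 • f)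
    (∑ i, ∂_{e i} (∂_{e i} f))
  simp only [LineDeriv.lineDerivOpCLM_apply, LineDeriv.lineDerivOp_smul,
    LineDeriv.lineDerivOp_sum] at h
  simp only [helmOp_apply, h, lineDerivOp_comm v]

open Laplacian in
theorem helmOp_eq_laplacian (k : ℝ) (f : 𝓢(Plane, F)) : helmOp k f = k ^ 2 • f - Δ f := by
  rw [SchwartzMap.laplacian_eq_sum (EuclideanSpace.basisFun (Fin 2) ℝ), helmOp_apply]
  simp [e]

theorem hasTemperateGrowth_resolvent {k : ℝ} (hk : k ≠ 0) :
    (fun x : Plane => (k ^ 2 + (2 * Real.pi) ^ 2 * ‖x‖ ^ 2)⁻¹).HasTemperateGrowth := by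
  have h1 := (Function.hasTemperateGrowth_one_add_norm_sq_rpow Plane (-1)).comp
    ((2 * Real.pi / k) • ContinuousLinearMap.id ℝ Plane).hasTemperateGrowth
  have h2 := (Function.HasTemperateGrowth.const (E := Plane) (k ^ 2)⁻¹).mul h1
  refine Eq.mp (congrArg _ ?_) h2
  funext x
  simp only [Pi.mul_apply, Function.comp_apply, smul_apply,
    ContinuousLinearMap.id_apply, Real.rpow_neg_one, norm_smul, ← mul_inv]
  rw [mul_pow, Real.norm_eq_abs, sq_abs]
  field_simp

/-- Solvability of `k² a - Δa = f` in the Schwartz space, for real-valued `f`: the solution is the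
Fourier multiplier with symbol `(k² + 4π²|ξ|²)⁻¹` applied to `f`, of which we take the real part. -/
theorem helmOp_surjective {k : ℝ} (hk : k ≠ 0) :
    Function.Surjective (helmOp k : 𝓢(Plane, ℝ) →ₗ[ℝ] 𝓢(Plane, ℝ)) := by
  intro f
  let fC : 𝓢(Plane, ℂ) := f.postcompCLM Complex.ofRealCLM
  let g : Plane → ℝ := fun x => (k ^ 2 + (2 * Real.pi) ^ 2 * ‖x‖ ^ 2)⁻¹
  have hg : g.HasTemperateGrowth := hasTemperateGrowth_resolvent hk
  have hn : (fun x : Plane => ‖x‖ ^ 2).HasTemperateGrowth :=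
    Function.hasTemperateGrowth_norm_sq _
  let aC : 𝓢(Plane, ℂ) := SchwartzMap.fourierMultiplierCLM ℂ g fC
  have hC : helmOp k aC = fC := by
    have hs := Function.HasTemperateGrowth.const (E := Plane) (k ^ 2)
    have hn' : ((2 * Real.pi) ^ 2 • fun x : Plane => ‖x‖ ^ 2).HasTemperateGrowth :=
      (Function.HasTemperateGrowth.const (E := Plane) ((2 * Real.pi) ^ 2)).mul hn
    have hsum : SchwartzMap.fourierMultiplierCLM ℂ
        ((fun _ : Plane => k ^ 2) + (2 * Real.pi) ^ 2 • fun x : Plane => ‖x‖ ^ 2) aC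
        = k ^ 2 • aC + (2 * Real.pi) ^ 2 •
          SchwartzMap.fourierMultiplierCLM ℂ (fun x : Plane => ‖x‖ ^ 2) aC := by
      rw [SchwartzMap.fourierMultiplierCLM_apply, SchwartzMap.smulLeftCLM_add hs hn',
        add_apply, FourierTransform.fourierInv_add,
        ← SchwartzMap.fourierMultiplierCLM_apply, ← SchwartzMap.fourierMultiplierCLM_apply,
        SchwartzMap.fourierMultiplierCLM_const, SchwartzMap.fourierMultiplierCLM_smul hn]
      rfl
    have hone : ((fun _ : Plane => k ^ 2) + (2 * Real.pi) ^ 2 • fun x : Plane => ‖x‖ ^ 2) * g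
        = fun _ : Plane => (1 : ℝ) := by
      ext x
      have : k ^ 2 + (2 * Real.pi) ^ 2 * ‖x‖ ^ 2 ≠ 0 := by positivity
      simpa [g] using mul_inv_cancel₀ this
    rw [SchwartzMap.fourierMultiplierCLM_fourierMultiplierCLM_apply (hs.add hn') hg, hone,
      SchwartzMap.fourierMultiplierCLM_const, one_smul] at hsum
    rw [helmOp_eq_laplacian, SchwartzMap.laplacian_eq_fourierMultiplierCLM, neg_smul,
      sub_neg_eq_add]
    exact hsum.symm
  refine ⟨aC.postcompCLM Complex.reCLM, ?_⟩
  rw [helmOp_postcompCLM, hC]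
  ext x
  simp [fC]

end Resolvent

/-! ### The gradient and the divergences on Schwartz functions -/

/-- The inclusion `t ↦ t e_j` of the `j`-th coordinate axis of `ℝ⁶`. -/
def axis (j : Fin 6) : ℝ →L[ℝ] R6 :=
  ContinuousLinearMap.toSpanSingleton ℝ (EuclideanSpace.single j 1)

theorem axis_apply (j i : Fin 6) (t : ℝ) : axis j t i = if i = j then t else 0 := by
  simp [axis]

/-- The Schwartz field with `j`-th component `a` and all other components zero. -/
def field (j : Fin 6) : 𝓢(Plane, ℝ) →L[ℝ] 𝓢(Plane, R6) := SchwartzMap.postcompCLM (axis j)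

/-- The `j`-th component of a Schwartz field. -/
def comp (j : Fin 6) : 𝓢(Plane, R6) →L[ℝ] 𝓢(Plane, ℝ) :=
  SchwartzMap.postcompCLM (EuclideanSpace.proj j)

theorem field_apply (j i : Fin 6) (a : 𝓢(Plane, ℝ)) (x : Plane) :
    field j a x i = if i = j then a x else 0 := axis_apply j i (a x)

theorem comp_apply (j : Fin 6) (s : 𝓢(Plane, R6)) (x : Plane) : comp j s x = s x j := rfl

theorem comp_field (j i : Fin 6) (a : 𝓢(Plane, ℝ)) :
    comp i (field j a) = if i = j then a else 0 := by
  ext x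
  rw [comp_apply, field_apply]
  split_ifs <;> rfl

theorem sum_field_comp (s : 𝓢(Plane, R6)) : ∑ j, field j (comp j s) = s := by
  ext x i
  rw [sum_apply, WithLp.ofLp_sum, Finset.sum_apply]
  simp [field_apply, comp_apply]

theorem lineDerivOp_field (v : Plane) (j : Fin 6) (a : 𝓢(Plane, ℝ)) :
    ∂_{v} (field j a) = field j (∂_{v} a) := lineDerivOp_postcompCLM v _ a

theorem helmOp_field (k : ℝ) (j : Fin 6) (a : 𝓢(Plane, ℝ)) :
    helmOp k (field j a) = field j (helmOp k a) := helmOp_postcompCLM k _ a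

/-- The gradient `gradFun k` on pairs of Schwartz functions. -/
def schwartzGrad (k : ℝ) : 𝓢(Plane, ℝ) × 𝓢(Plane, ℝ) →L[ℝ] 𝓢(Plane, R6) :=
  let D := fun i => LineDeriv.lineDerivOpCLM ℝ 𝓢(Plane, ℝ) (e i)
  (field 0 ∘L D 0 + field 1 ∘L D 1 - k • field 5) ∘L ContinuousLinearMap.fst ℝ _ _ +
    (field 3 ∘L D 0 + field 4 ∘L D 1 + k • field 2) ∘L ContinuousLinearMap.snd ℝ _ _

theorem schwartzGrad_eq (k : ℝ) (α β : 𝓢(Plane, ℝ)) :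
    schwartzGrad k (α, β) = field 0 (∂_{e 0} α) + field 1 (∂_{e 1} α) - k • field 5 α +
      (field 3 (∂_{e 0} β) + field 4 (∂_{e 1} β) + k • field 2 β) := rfl

theorem lineDerivOp_testToSchwartz {F : Type} [NormedAddCommGroup F] [NormedSpace ℝ F]
    (v : Plane) (φ : Test F) : ∂_{v} (testToSchwartz φ) = testToSchwartz (∂_{v} φ) := by
  ext x
  rw [SchwartzMap.lineDerivOp_apply, testToSchwartz_apply,
    TestFunction.lineDerivOp_eq_lineDerivCLM (𝕜 := ℝ),
    TestFunction.lineDerivCLM_apply_of_le (by simp)]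
  rfl

theorem schwartzGrad_testToSchwartz (k : ℝ) (α β : Test ℝ) :
    schwartzGrad k (testToSchwartz α, testToSchwartz β) = testToSchwartz (grad k (α, β)) := by
  ext x j
  rw [testToSchwartz_apply]
  change _ = gradFun k α β x j
  rw [schwartzGrad_eq]
  fin_cases j <;> simp [field_apply, gradFun, lineDerivOp_testToSchwartz]

/-- The first component of the formal adjoint of the gradient. -/
def divFst (k : ℝ) (s : 𝓢(Plane, R6)) : 𝓢(Plane, ℝ) :=
  -∂_{e 0} (comp 0 s) - ∂_{e 1} (comp 1 s) - k • comp 5 s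

/-- The second component of the formal adjoint of the gradient. -/
def divSnd (k : ℝ) (s : 𝓢(Plane, R6)) : 𝓢(Plane, ℝ) :=
  k • comp 2 s - ∂_{e 0} (comp 3 s) - ∂_{e 1} (comp 4 s)

theorem comp_schwartzGrad (k : ℝ) (α β : 𝓢(Plane, ℝ)) (j : Fin 6) :
    comp j (schwartzGrad k (α, β)) =
      ![∂_{e 0} α, ∂_{e 1} α, k • β, ∂_{e 0} β, ∂_{e 1} β, -(k • α)] j := by
  rw [schwartzGrad_eq]
  simp only [map_add, map_sub, map_smul, comp_field]
  fin_cases j <;> simp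

theorem divFst_schwartzGrad (k : ℝ) (α β : 𝓢(Plane, ℝ)) :
    divFst k (schwartzGrad k (α, β)) = helmOp k α := by
  simp only [divFst, comp_schwartzGrad, helmOp_apply, Fin.sum_univ_two]
  simp only [Matrix.cons_val]
  rw [smul_neg, smul_smul, pow_two]
  abel

theorem divSnd_schwartzGrad (k : ℝ) (α β : 𝓢(Plane, ℝ)) :
    divSnd k (schwartzGrad k (α, β)) = helmOp k β := by
  simp only [divSnd, comp_schwartzGrad, helmOp_apply, Fin.sum_univ_two]
  simp only [Matrix.cons_val]
  rw [smul_smul, pow_two]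
  abel

theorem helmOp_schwartzGrad (k : ℝ) (α β : 𝓢(Plane, ℝ)) :
    helmOp k (schwartzGrad k (α, β)) = schwartzGrad k (helmOp k α, helmOp k β) := by
  simp only [schwartzGrad_eq, map_add, map_sub, map_smul, helmOp_field, helmOp_lineDerivOp]

/-! ### Pairings with Schwartz fields in `L²` -/

/-- The class in `L²(ℝ²)⁶` of a Schwartz field. -/
def schwartzToL2 : 𝓢(Plane, R6) →L[ℝ] L2 := SchwartzMap.toLpCLM ℝ R6 2 volume

theorem schwartzToL2_ae_eq (s : 𝓢(Plane, R6)) : schwartzToL2 s =ᵐ[volume] s :=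
  s.coeFn_toLp 2 volume

theorem schwartzToL2_testToSchwartz (φ : Test R6) :
    schwartzToL2 (testToSchwartz φ) = testToL2 φ := rfl

theorem integrable_schwartz_smul (a : 𝓢(Plane, ℝ)) (u : L2) : Integrable fun x => a x • u x :=
  memLp_one_iff_integrable.1 ((Lp.memLp u).smul (a.memLp 2))

theorem inner_schwartzToL2_field (u : L2) (j : Fin 6) (a : 𝓢(Plane, ℝ)) :
    inner ℝ u (schwartzToL2 (field j a)) = (∫ x, a x • u x) j := by
  have h := (EuclideanSpace.proj (𝕜 := ℝ) j : R6 →L[ℝ] ℝ).integral_comp_comm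
    (integrable_schwartz_smul a u)
  change _ = EuclideanSpace.proj (𝕜 := ℝ) j (∫ x, a x • u x)
  rw [← h, L2.inner_def]
  refine integral_congr_ae ?_
  filter_upwards [schwartzToL2_ae_eq (field j a)] with x hx
  rw [hx, PiLp.inner_apply]
  simp [field_apply]

/-- Duality between a weak derivative and Schwartz fields. -/
theorem isWeakPartial_iff_inner {i : Fin 2} {u g : L2} :
    IsWeakPartial i u g ↔ ∀ s : 𝓢(Plane, R6),
      inner ℝ g (schwartzToL2 s) = -inner ℝ u (schwartzToL2 (∂_{e i} s)) := by
  have hφ : IsWeakPartial i u g ↔ ∀ (j : Fin 6) (φ : Test ℝ),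
      inner ℝ g (schwartzToL2 (field j (testToSchwartz φ))) =
        -inner ℝ u (schwartzToL2 (field j (∂_{e i} (testToSchwartz φ)))) := by
    simp only [inner_schwartzToL2_field, lineDerivOp_testToSchwartz, testToSchwartz_apply]
    constructor
    · intro h j φ
      rw [h φ]
      simp
    · intro h φ
      ext j
      have := h j φ
      simp only [PiLp.neg_apply]
      linarith
  rw [hφ]
  constructor
  · intro h
    have hs : ∀ (j : Fin 6) (a : 𝓢(Plane, ℝ)),
        inner ℝ g (schwartzToL2 (field j a)) =
          -inner ℝ u (schwartzToL2 (field j (∂_{e i} a))) := by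
      intro j
      refine isClosed_property denseRange_testToSchwartz ?_ (h j)
      have hD : Continuous fun a : 𝓢(Plane, ℝ) => (∂_{e i} a : 𝓢(Plane, ℝ)) :=
        (LineDeriv.lineDerivOpCLM ℝ 𝓢(Plane, ℝ) (e i)).continuous
      exact isClosed_eq (by fun_prop) (by fun_prop)
    intro s
    rw [← sum_field_comp s]
    simp only [LineDeriv.lineDerivOp_sum, map_sum, inner_sum, hs, lineDerivOp_field,
      Finset.sum_neg_distrib]
  · intro h j φ
    rw [← lineDerivOp_field, h]

theorem isClosed_isWeakPartial (i : Fin 2) : IsClosed {z : L2 × L2 | IsWeakPartial i z.1 z.2} := by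
  simp only [isWeakPartial_iff_inner, Set.ofPred_forall]
  refine isClosed_iInter fun s => isClosed_eq (by fun_prop) (by fun_prop)

/-- Integration by parts: the pair of divergences is the formal adjoint of the gradient. -/
theorem inner_schwartzToL2_schwartzGrad (k : ℝ) (s : 𝓢(Plane, R6)) (α β : 𝓢(Plane, ℝ)) :
    inner ℝ (schwartzToL2 s) (schwartzToL2 (schwartzGrad k (α, β))) =
      (∫ x, α x * divFst k s x) + ∫ x, β x * divSnd k s x := by
  let T : 𝓢(Plane, ℝ) →L[ℝ] Lp ℝ 2 (volume : Measure Plane) := SchwartzMap.toLpCLM ℝ ℝ 2 volume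
  have hT : ∀ a b : 𝓢(Plane, ℝ), inner ℝ (T a) (T b) = ∫ x, a x * b x := by
    intro a b
    rw [L2.inner_def]
    refine integral_congr_ae ?_
    filter_upwards [a.coeFn_toLp 2 volume, b.coeFn_toLp 2 volume] with x ha hb
    change inner ℝ (a.toLp 2 volume x) (b.toLp 2 volume x) = _
    rw [ha, hb]
    simp [mul_comm]
  have hf : ∀ (j : Fin 6) (a : 𝓢(Plane, ℝ)),
      inner ℝ (schwartzToL2 s) (schwartzToL2 (field j a)) = inner ℝ (T a) (T (comp j s)) := by
    intro j a
    rw [hT, L2.inner_def]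
    refine integral_congr_ae ?_
    filter_upwards [schwartzToL2_ae_eq s, schwartzToL2_ae_eq (field j a)] with x h1 h2
    rw [h1, h2, PiLp.inner_apply]
    simp [field_apply, comp_apply]
  have hp : ∀ (v : Plane) (a b : 𝓢(Plane, ℝ)),
      inner ℝ (T (∂_{v} a)) (T b) = -inner ℝ (T a) (T (∂_{v} b)) := by
    intro v a b
    rw [hT, hT, SchwartzMap.integral_mul_lineDerivOp_right_eq_neg_left, neg_neg]
  rw [← hT, ← hT, schwartzGrad_eq, divFst, divSnd]
  simp only [map_add, map_sub, map_neg, map_smul, inner_add_right, inner_sub_right,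
    inner_neg_right, inner_smul_right, hf, hp]
  ring

/-! ### Schwartz fields in `H¹` and in `𝒱` -/

theorem isWeakPartial_schwartzToL2 (i : Fin 2) (s : 𝓢(Plane, R6)) :
    IsWeakPartial i (schwartzToL2 s) (schwartzToL2 (∂_{e i} s)) := by
  intro φ
  have key : ∀ (ψ : Test ℝ) (t : 𝓢(Plane, R6)),
      ∫ x, ψ x • schwartzToL2 t x = ∫ x, testToSchwartz ψ x • t x := by
    intro ψ t
    refine integral_congr_ae ?_
    filter_upwards [schwartzToL2_ae_eq t] with x hx
    rw [hx, testToSchwartz_apply]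
  rw [key, key, SchwartzMap.integral_smul_lineDerivOp_right_eq_neg_left, neg_neg,
    lineDerivOp_testToSchwartz]

/-- The element of `H¹(ℝ²)⁶` given by a Schwartz field. -/
def schwartzToH1 : 𝓢(Plane, R6) →ₗ[ℝ] H1 where
  toFun s := ⟨schwartzToL2 s, fun i => ⟨_, isWeakPartial_schwartzToL2 i s⟩⟩
  map_add' s t := Subtype.ext (map_add schwartzToL2 s t)
  map_smul' c s := Subtype.ext (map_smul schwartzToL2 c s)

theorem toL2_schwartzToH1 (s : 𝓢(Plane, R6)) : H1.toL2 (schwartzToH1 s) = schwartzToL2 s := rfl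

theorem partial_schwartzToH1 (i : Fin 2) (s : 𝓢(Plane, R6)) :
    H1.partial i (schwartzToH1 s) = schwartzToL2 (∂_{e i} s) :=
  (H1.isWeakPartial i (schwartzToH1 s)).unique (isWeakPartial_schwartzToL2 i s)

/-- The pairing of the jets of `u ∈ H¹` and a Schwartz field, integrated by parts. -/
theorem inner_jet_schwartzToH1 (k : ℝ) (u : H1) (s : 𝓢(Plane, R6)) :
    inner ℝ (H1.jet k u) (H1.jet k (schwartzToH1 s)) =
      inner ℝ (H1.toL2 u) (schwartzToL2 (helmOp k s)) := by
  have h1 : inner ℝ (H1.jet k u) (H1.jet k (schwartzToH1 s)) =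
      inner ℝ (k • H1.toL2 u) (k • H1.toL2 (schwartzToH1 s)) +
        ∑ i, inner ℝ (H1.partial i u) (H1.partial i (schwartzToH1 s)) := by
    rw [WithLp.prod_inner_apply, PiLp.inner_apply]
    rfl
  rw [h1, helmOp_apply, map_sub, map_smul, map_sum, inner_sub_right, inner_sum, toL2_schwartzToH1]
  simp only [partial_schwartzToH1, isWeakPartial_iff_inner.1 (H1.isWeakPartial _ u),
    real_inner_smul_left, real_inner_smul_right, Finset.sum_neg_distrib]
  ring

/-- Elements of `𝒱` are orthogonal to the gradients of all Schwartz functions, because these are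
limits of gradients of test functions. -/
theorem forall_inner_schwartzGrad_eq_zero {k : ℝ} {u : L2}
    (h : ∀ α β : Test ℝ, inner ℝ u (testToL2 (grad k (α, β))) = 0)
    (a : 𝓢(Plane, ℝ) × 𝓢(Plane, ℝ)) : inner ℝ u (schwartzToL2 (schwartzGrad k a)) = 0 := by
  have hc : IsClosed {a | inner ℝ u (schwartzToL2 (schwartzGrad k a)) = 0} :=
    isClosed_eq (by fun_prop) continuous_const
  refine isClosed_property (denseRange_testToSchwartz.prodMap denseRange_testToSchwartz) hc ?_ a
  rintro ⟨α, β⟩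
  rw [Prod.map_apply, schwartzGrad_testToSchwartz, schwartzToL2_testToSchwartz, h]

theorem schwartzToH1_mem_V {k : ℝ} {s : 𝓢(Plane, R6)} (h1 : divFst k s = 0)
    (h2 : divSnd k s = 0) : schwartzToH1 s ∈ V k := by
  intro α β
  rw [← schwartzToL2_testToSchwartz, ← schwartzGrad_testToSchwartz, toL2_schwartzToH1,
    inner_schwartzToL2_schwartzGrad, h1, h2]
  simp

/-- An `L²` field that is orthogonal to `(k² - Δ) φ` for all Schwartz fields `φ` vanishes, since
`k² - Δ` is onto. -/
theorem eq_zero_of_inner_helmOp {k : ℝ} (hk : k ≠ 0) {u : L2}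
    (h : ∀ s : 𝓢(Plane, R6), inner ℝ u (schwartzToL2 (helmOp k s)) = 0) : u = 0 := by
  have h1 : ∀ s : 𝓢(Plane, R6), inner ℝ u (schwartzToL2 s) = 0 := by
    intro s
    rw [← sum_field_comp s, map_sum, inner_sum]
    refine Finset.sum_eq_zero fun j _ => ?_
    obtain ⟨a, ha⟩ := helmOp_surjective hk (comp j s)
    rw [← ha, ← helmOp_field]
    exact h _
  have h2 : inner ℝ u u = 0 :=
    isClosed_property (SchwartzMap.denseRange_toLpCLM (p := 2) (by norm_num))
      (isClosed_eq (by fun_prop) continuous_const : IsClosed {v : L2 | inner ℝ u v = 0}) h1 u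
  exact inner_self_eq_zero.1 h2

/-! ### Closedness and completeness -/

theorem continuous_toL2_H1 : Continuous H1.toL2 := by
  refine (LinearMap.mkContinuous H1.toL2 1 fun u => ?_).continuous
  rw [one_mul, H1.norm_eq]
  refine Real.le_sqrt_of_sq_le ?_
  exact le_add_of_nonneg_left (Finset.sum_nonneg fun _ _ => sq_nonneg _)

theorem isClosed_V (k : ℝ) : IsClosed (V k : Set H1) := by
  have : (V k : Set H1) = ⋂ α : Test ℝ, ⋂ β : Test ℝ,
      {u | inner ℝ (H1.toL2 u) (testToL2 (grad k (α, β))) = 0} := by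
    ext u
    simp only [Set.mem_iInter]
    rfl
  rw [this]
  exact isClosed_iInter fun α => isClosed_iInter fun β =>
    isClosed_eq (continuous_toL2_H1.inner continuous_const) continuous_const

instance completeSpace_VSpace (k : ℝ) [NeZero k] : CompleteSpace (VSpace k) := by
  have hk : k ≠ 0 := NeZero.ne k
  let J : VSpace k →ₗ[ℝ] WithLp 2 (L2 × PiLp 2 fun _ : Fin 2 => L2) :=
    H1.jet k ∘ₗ VSpace.toH1 k
  have hJ : Isometry J := AddMonoidHomClass.isometry_of_norm J fun _ => rfl
  rw [completeSpace_iff_isComplete_range hJ.isUniformInducing]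
  refine IsClosed.isComplete ?_
  have hr : Set.range J =
      (⋂ i : Fin 2, {z | IsWeakPartial i (k⁻¹ • z.fst) (z.snd i)}) ∩
        ⋂ α : Test ℝ, ⋂ β : Test ℝ,
          {z | inner ℝ (k⁻¹ • z.fst) (testToL2 (grad k (α, β))) = 0} := by
    ext z
    simp only [Set.mem_range, Set.mem_inter_iff, Set.mem_iInter, Set.mem_ofPred_eq]
    constructor
    · rintro ⟨v, rfl⟩
      have h1 : k⁻¹ • (J v).fst = H1.toL2 (VSpace.toH1 k v) := inv_smul_smul₀ hk _
      rw [h1]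
      exact ⟨fun i => H1.isWeakPartial i _, fun α β => v.2 α β⟩
    · rintro ⟨h1, h2⟩
      let u : H1 := ⟨k⁻¹ • z.fst, fun i => ⟨_, h1 i⟩⟩
      refine ⟨⟨u, h2⟩, ?_⟩
      have hp : ∀ i, H1.partial i u = z.snd i := fun i => (H1.isWeakPartial i u).unique (h1 i)
      have h3 : k • H1.toL2 u = z.fst := smul_inv_smul₀ hk _
      change WithLp.toLp 2 (k • H1.toL2 u, WithLp.toLp 2 fun i => H1.partial i u) = z
      rw [h3, funext hp]
      rfl
  rw [hr]
  have hf : Continuous fun z : WithLp 2 (L2 × PiLp 2 fun _ : Fin 2 => L2) => z.fst := by fun_prop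
  refine (isClosed_iInter fun i => ?_).inter
    (isClosed_iInter fun α => isClosed_iInter fun β => ?_)
  · exact (isClosed_isWeakPartial i).preimage
      (f := fun z : WithLp 2 (L2 × PiLp 2 fun _ : Fin 2 => L2) => (k⁻¹ • z.fst, z.snd i))
      (by fun_prop)
  · exact isClosed_eq (by fun_prop) continuous_const

section

variable (p : ℝ≥0∞) [Fact (1 ≤ p)]

theorem isometry_pair : Isometry (L2Lp.pair p) :=
  AddMonoidHomClass.isometry_of_norm (L2Lp.pair p) fun _ => rfl

theorem continuous_toL2_L2Lp : Continuous (L2Lp.toL2 p) := by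
  have h : (fun u => (L2Lp.pair p u).fst) = L2Lp.toL2 p := rfl
  have hf : Continuous fun z : WithLp 2 (L2 × Lp R6 p (volume : Measure Plane)) => z.fst := by
    fun_prop
  rw [← h]
  exact hf.comp (isometry_pair p).continuous

instance completeSpace_L2Lp : CompleteSpace (L2Lp p) := by
  rw [completeSpace_iff_isComplete_range (isometry_pair p).isUniformInducing]
  refine IsClosed.isComplete (IsSeqClosed.isClosed ?_)
  intro x z hx hz
  have hf : Continuous fun z : WithLp 2 (L2 × Lp R6 p (volume : Measure Plane)) => z.fst := by
    fun_prop
  have hs : Continuous fun z : WithLp 2 (L2 × Lp R6 p (volume : Measure Plane)) => z.snd := by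
    fun_prop
  have h1 := tendstoInMeasure_of_tendsto_Lp ((hf.tendsto z).comp hz)
  have h2 := tendstoInMeasure_of_tendsto_Lp ((hs.tendsto z).comp hz)
  have h3 : ∀ n, (x n).snd =ᵐ[volume] (x n).fst := by
    intro n
    obtain ⟨u, hu⟩ := hx n
    rw [← hu]
    exact L2Lp.toLp_ae_eq p u
  -- both components converge in measure to the same limit
  have h4 : z.snd =ᵐ[volume] z.fst :=
    tendstoInMeasure_ae_unique h2 (h1.congr_left fun n => (h3 n).symm)
  have h5 : MemLp (⇑z.fst) p (volume : Measure Plane) := (Lp.memLp z.snd).ae_eq h4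
  refine ⟨⟨z.fst, h5⟩, ?_⟩
  have h6 : L2Lp.toLp p ⟨z.fst, h5⟩ = z.snd := Lp.ext ((L2Lp.toLp_ae_eq p _).trans h4.symm)
  change WithLp.toLp 2 (z.fst, L2Lp.toLp p ⟨z.fst, h5⟩) = z
  rw [h6]
  rfl

theorem isClosed_W (k : ℝ) : IsClosed (W k p : Set (L2Lp p)) :=
  Submodule.isClosed_topologicalClosure _

instance completeSpace_W (k : ℝ) : CompleteSpace (W k p) :=
  (isClosed_W p k).completeSpace_coe

/-! ### Orthogonality and the direct sum -/

theorem inner_V_W (k : ℝ) (v : H1) (hv : v ∈ V k) (w : L2Lp p) (hw : w ∈ W k p) :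
    inner ℝ (H1.toL2 v) (L2Lp.toL2 p w) = 0 := by
  have hc : IsClosed {w : L2Lp p | inner ℝ (H1.toL2 v) (L2Lp.toL2 p w) = 0} :=
    isClosed_eq (continuous_const.inner (continuous_toL2_L2Lp p)) continuous_const
  refine closure_minimal ?_ hc hw
  rintro _ ⟨⟨α, β⟩, rfl⟩
  exact hv α β

theorem injective_toL2_X (k : ℝ) : Function.Injective (X.toL2 k p) := by
  rw [← LinearMap.ker_eq_bot, LinearMap.ker_eq_bot']
  intro u hu
  have hu' : H1.toL2 (VSpace.toH1 k u.fst) + L2Lp.toL2 p u.snd = 0 := hu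
  have ho := inner_V_W p k _ u.fst.2 _ u.snd.2
  have hv : H1.toL2 (VSpace.toH1 k u.fst) = 0 := by
    rw [eq_neg_of_add_eq_zero_right hu', inner_neg_right, neg_eq_zero] at ho
    exact inner_self_eq_zero.1 ho
  rw [hv, zero_add] at hu'
  have h1 : u.fst = 0 := Subtype.ext (H1.toL2_injective (hv.trans (map_zero _).symm))
  have h2 : u.snd = 0 := Subtype.ext (Subtype.ext hu')
  refine (WithLp.ofLp_injective 1) (Prod.ext h1 h2)

end

/-! ### The decomposition of Schwartz fields -/

theorem divFst_sub (k : ℝ) (s t : 𝓢(Plane, R6)) : divFst k (s - t) = divFst k s - divFst k t := by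
  simp only [divFst, map_sub]
  simp only [sub_eq_add_neg, LineDeriv.lineDerivOp_add, LineDeriv.lineDerivOp_neg, smul_add,
    smul_neg, neg_add]
  abel

theorem divSnd_sub (k : ℝ) (s t : 𝓢(Plane, R6)) : divSnd k (s - t) = divSnd k s - divSnd k t := by
  simp only [divSnd, map_sub]
  simp only [sub_eq_add_neg, LineDeriv.lineDerivOp_add, LineDeriv.lineDerivOp_neg, smul_add,
    smul_neg, neg_add]
  abel

/-- The Helmholtz decomposition of a Schwartz field `s`: the potentials solve
`k² α - Δα = divFst k s` and `k² β - Δβ = divSnd k s`. -/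
theorem exists_sub_schwartzGrad_mem_V {k : ℝ} (hk : k ≠ 0) (s : 𝓢(Plane, R6)) :
    ∃ a, schwartzToH1 (s - schwartzGrad k a) ∈ V k := by
  obtain ⟨α, hα⟩ := helmOp_surjective hk (divFst k s)
  obtain ⟨β, hβ⟩ := helmOp_surjective hk (divSnd k s)
  refine ⟨(α, β), schwartzToH1_mem_V ?_ ?_⟩
  · rw [divFst_sub, divFst_schwartzGrad, hα, sub_self]
  · rw [divSnd_sub, divSnd_schwartzGrad, hβ, sub_self]

section

variable (p : ℝ≥0∞)

/-- The element of `L² ∩ Lᵖ` given by a Schwartz field. -/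
def schwartzToL2Lp (s : 𝓢(Plane, R6)) : L2Lp p :=
  ⟨schwartzToL2 s, (s.memLp p).ae_eq (schwartzToL2_ae_eq s).symm⟩

variable [Fact (1 ≤ p)]

theorem continuous_schwartzToL2Lp : Continuous (schwartzToL2Lp p) := by
  rw [(isometry_pair p).isUniformInducing.isInducing.continuous_iff]
  have h : L2Lp.pair p ∘ schwartzToL2Lp p = fun s => WithLp.toLp 2
      (schwartzToL2 s, SchwartzMap.toLpCLM ℝ R6 p volume s) := by
    funext s
    have h1 : L2Lp.toLp p (schwartzToL2Lp p s) = SchwartzMap.toLpCLM ℝ R6 p volume s :=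
      Lp.ext (((L2Lp.toLp_ae_eq p _).trans (schwartzToL2_ae_eq s)).trans
        (s.coeFn_toLp p volume).symm)
    change WithLp.toLp 2 (schwartzToL2 s, L2Lp.toLp p (schwartzToL2Lp p s)) = _
    rw [h1]
  rw [h]
  fun_prop

/-- Gradients of Schwartz functions belong to `𝒲`: they are limits of gradients of test functions,
since the topology of the Schwartz space is finer than that of `L² ∩ Lᵖ`. -/
theorem schwartzGrad_mem_W (k : ℝ) (a : 𝓢(Plane, ℝ) × 𝓢(Plane, ℝ)) :
    schwartzToL2Lp p (schwartzGrad k a) ∈ W k p := by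
  have hc : IsClosed {a | schwartzToL2Lp p (schwartzGrad k a) ∈ W k p} :=
    (isClosed_W p k).preimage ((continuous_schwartzToL2Lp p).comp (schwartzGrad k).continuous)
  refine isClosed_property (denseRange_testToSchwartz.prodMap denseRange_testToSchwartz) hc ?_ a
  rintro ⟨α, β⟩
  rw [Prod.map_apply, schwartzGrad_testToSchwartz]
  exact Submodule.le_topologicalClosure _ ⟨(α, β), rfl⟩

variable (k : ℝ) [NeZero k]

theorem exists_toL2_eq_testToL2 (φ : Test R6) : ∃ u : X k p,
    X.toL2 k p u = testToL2 φ ∧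
      ∃ a, VSpace.toH1 k u.fst = schwartzToH1 (testToSchwartz φ - schwartzGrad k a) := by
  obtain ⟨a, ha⟩ := exists_sub_schwartzGrad_mem_V (NeZero.ne k) (testToSchwartz φ)
  refine ⟨WithLp.toLp 1 (⟨_, ha⟩, ⟨_, schwartzGrad_mem_W p k a⟩), ?_, a, rfl⟩
  change schwartzToL2 (testToSchwartz φ - schwartzGrad k a) + schwartzToL2 (schwartzGrad k a) = _
  rw [← map_add, sub_add_cancel, schwartzToL2_testToSchwartz]

/-- The embedding of the test fields into `X = 𝒱 ⊕ 𝒲`. It is the decomposition of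
`exists_sub_schwartzGrad_mem_V`, obtained by inverting the injective map `X.toL2` on its range, so
that linearity needs no choice of linear potentials. -/
def testToX : Test R6 →ₗ[ℝ] X k p :=
  (LinearEquiv.ofInjective (X.toL2 k p) (injective_toL2_X p k)).symm.toLinearMap ∘ₗ
    testToL2.codRestrict (LinearMap.range (X.toL2 k p)) fun φ =>
      (exists_toL2_eq_testToL2 p k φ).imp fun _ h => h.1

theorem toL2_testToX (φ : Test R6) : X.toL2 k p (testToX p k φ) = testToL2 φ :=
  congrArg Subtype.val <|
    (LinearEquiv.ofInjective (X.toL2 k p) (injective_toL2_X p k)).apply_symm_apply <|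
    testToL2.codRestrict (LinearMap.range (X.toL2 k p)) (fun φ =>
      (exists_toL2_eq_testToL2 p k φ).imp fun _ h => h.1) φ

theorem exists_toH1_testToX (φ : Test R6) : ∃ a,
    VSpace.toH1 k (testToX p k φ).fst = schwartzToH1 (testToSchwartz φ - schwartzGrad k a) := by
  obtain ⟨u, hu, a, ha⟩ := exists_toL2_eq_testToL2 p k φ
  have : testToX p k φ = u := injective_toL2_X p k ((toL2_testToX p k φ).trans hu.symm)
  exact ⟨a, this ▸ ha⟩

/-! ### Density of the test fields -/

/-- `{0} × 𝒲` lies in the closure of the test fields, because gradients of test functions are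
themselves test fields. -/
theorem toLp_zero_W_mem_closure (w : W k p) :
    WithLp.toLp 1 ((0 : VSpace k), w) ∈ closure (Set.range (testToX p k)) := by
  rw [Metric.mem_closure_range_iff]
  intro ε hε
  obtain ⟨_, ⟨a, rfl⟩, ha⟩ := Metric.mem_closure_iff.1 w.2 ε hε
  let g : W k p := ⟨testToL2Lp p (grad k a), Submodule.le_topologicalClosure _ ⟨a, rfl⟩⟩
  refine ⟨grad k a, ?_⟩
  have h : testToX p k (grad k a) = WithLp.toLp 1 ((0 : VSpace k), g) := by
    refine injective_toL2_X p k ((toL2_testToX p k _).trans ?_)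
    exact (zero_add (testToL2 (grad k a))).symm
  rw [h, WithLp.prod_dist_eq_of_L1]
  change dist (0 : VSpace k) 0 + dist w g < ε
  rw [dist_self, zero_add]
  exact ha

/-- The `𝒱`-parts of the test fields are dense in `𝒱`. An element of `𝒱` orthogonal to all of them
for the inner product of the jets is `L²`-orthogonal to `(k² - Δ) φ` for all test fields `φ`, and so
vanishes. -/
theorem dense_fst_testToX : DenseRange fun φ => (testToX p k φ).fst := by
  have hk : k ≠ 0 := NeZero.ne k
  intro v
  let J : VSpace k →ₗ[ℝ] WithLp 2 (L2 × PiLp 2 fun _ : Fin 2 => L2) :=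
    H1.jet k ∘ₗ VSpace.toH1 k
  have hJ : Isometry J := AddMonoidHomClass.isometry_of_norm J fun _ => rfl
  let fstι : Test R6 →ₗ[ℝ] VSpace k := 
    { toFun φ := (testToX p k φ).fst
      map_add' φ ψ := by rw [map_add, WithLp.add_fst]
      map_smul' c φ := by rw [map_smul, WithLp.smul_fst, RingHom.id_apply] }
  let P := (LinearMap.range (J ∘ₗ fstι)).topologicalClosure
  have hP : ∀ y ∈ P, ∃ v', J v' = y := by
    -- `J` is an isometry on a complete space
    have hcl : IsClosed (Set.range J) := hJ.isClosedEmbedding.isClosed_range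
    intro y hy
    refine closure_minimal ?_ hcl hy
    rintro _ ⟨φ, rfl⟩
    exact ⟨fstι φ, rfl⟩
  have : CompleteSpace P := (Submodule.isClosed_topologicalClosure _).completeSpace_coe
  obtain ⟨v', hv'⟩ := hP _ (P.starProjection_apply_mem (J v))
  have horth : ∀ φ, inner ℝ (J (v - v')) (J (fstι φ)) = 0 := by
    intro φ
    rw [map_sub, hv']
    exact P.starProjection_inner_eq_zero _ _
      (Submodule.le_topologicalClosure _ (LinearMap.mem_range_self (J ∘ₗ fstι) φ))
  have hL2 : H1.toL2 (VSpace.toH1 k (v - v')) = 0 := by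
    refine eq_zero_of_inner_helmOp hk ?_
    have hcont : Continuous (helmOp k : 𝓢(Plane, R6) →ₗ[ℝ] 𝓢(Plane, R6)) :=
      continuous_helmOp k
    refine isClosed_property denseRange_testToSchwartz
      (isClosed_eq (by fun_prop) continuous_const) fun φ => ?_
    obtain ⟨⟨α, β⟩, ha⟩ := exists_toH1_testToX p k φ
    have h1 : inner ℝ (H1.jet k (VSpace.toH1 k (v - v')))
        (H1.jet k (VSpace.toH1 k (testToX p k φ).fst)) = 0 := horth φ
    rw [ha, inner_jet_schwartzToH1, map_sub (helmOp k), map_sub schwartzToL2, inner_sub_right,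
      helmOp_schwartzGrad,
      
      forall_inner_schwartzGrad_eq_zero (u := H1.toL2 (VSpace.toH1 k (v - v'))) (v - v').2,
      sub_zero] at h1
    exact h1
  have hvv : v = v' :=
    sub_eq_zero.1 (Subtype.ext (H1.toL2_injective (hL2.trans (map_zero _).symm)))
  have hmem : J v ∈ P := by
    rw [hvv, hv']
    exact P.starProjection_apply_mem (J v)
  rw [hJ.isEmbedding.isInducing.closure_eq_preimage_closure_image]
  have himg : J '' (Set.range fun φ => (testToX p k φ).fst) = LinearMap.range (J ∘ₗ fstι) := by
    rw [← Set.range_comp]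
    rfl
  rw [Set.mem_preimage, himg]
  exact hmem

theorem denseRange_testToX : DenseRange (testToX p k) := by
  let D : Submodule ℝ (X k p) := (LinearMap.range (testToX p k)).topologicalClosure
  have hW : ∀ w : W k p, WithLp.toLp 1 ((0 : VSpace k), w) ∈ D := toLp_zero_W_mem_closure p k
  have hV : ∀ v : VSpace k, WithLp.toLp 1 (v, (0 : W k p)) ∈ D := by
    have hc : IsClosed {v : VSpace k | WithLp.toLp 1 (v, (0 : W k p)) ∈ D} :=
      (Submodule.isClosed_topologicalClosure _).preimage
        (f := fun v : VSpace k => (WithLp.toLp 1 (v, (0 : W k p)) : X k p)) (by fun_prop)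
    refine isClosed_property (dense_fst_testToX p k) hc fun φ => ?_
    have h1 : testToX p k φ ∈ D := Submodule.le_topologicalClosure _ ⟨φ, rfl⟩
    have h2 := D.sub_mem h1 (hW (testToX p k φ).snd)
    have h3 : testToX p k φ - WithLp.toLp 1 ((0 : VSpace k), (testToX p k φ).snd) =
        WithLp.toLp 1 ((testToX p k φ).fst, (0 : W k p)) :=
      WithLp.ofLp_injective 1 (Prod.ext (sub_zero _) (sub_self _))
    rwa [h3] at h2
  intro u
  have h := D.add_mem (hV u.fst) (hW u.snd)
  have h' : WithLp.toLp 1 (u.fst, (0 : W k p)) + WithLp.toLp 1 ((0 : VSpace k), u.snd) = u :=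
    WithLp.ofLp_injective 1 (Prod.ext (add_zero _) (zero_add _))
  rw [h'] at h
  exact h

end

end Helmholtz

end

theorem theorem2p1 (k : ℝ) [NeZero k] (p : ℝ≥0∞) [Fact (1 ≤ p)] (hp : 2 < p) (hp' : p ≠ ⊤) :
    -- `𝒱` and `𝒲` are closed in `H¹` and in `L² ∩ Lᵖ`
    IsClosed (Helmholtz.V k : Set Helmholtz.H1) ∧
    IsClosed (Helmholtz.W k p : Set (Helmholtz.L2Lp p)) ∧
    -- `𝒱` and `𝒲` are orthogonal in `L²`
    (∀ v ∈ Helmholtz.V k, ∀ w ∈ Helmholtz.W k p,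
      inner ℝ (Helmholtz.H1.toL2 v) (Helmholtz.L2Lp.toL2 p w) = 0) ∧
    -- the sum `𝒱 + 𝒲` of subspaces of `L²` is direct
    Function.Injective (Helmholtz.X.toL2 k p) ∧
    -- `X` is complete, contains all test fields, and they are dense in it
    CompleteSpace (Helmholtz.X k p) ∧
    ∃ ι : Helmholtz.Test Helmholtz.R6 →ₗ[ℝ] Helmholtz.X k p,
      (∀ φ, Helmholtz.X.toL2 k p (ι φ) = Helmholtz.testToL2 φ) ∧ DenseRange ι :=
  ⟨Helmholtz.isClosed_V k, Helmholtz.isClosed_W p k, Helmholtz.inner_V_W p k,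
    Helmholtz.injective_toL2_X p k, inferInstance, Helmholtz.testToX p k,
    Helmholtz.toL2_testToX p k, Helmholtz.denseRange_testToX p k⟩
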